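/- Let $(X(t))_{t\ge 0}$ be one-dimensional Brownian motion, regarded as a Markov process $(\Omega,(\mathcal F_t),X,(\mathbb P^x)_{x\in\mathbb R})$: $X$ has continuous paths and is adapted to $(\mathcal F_t)$, and under $\mathbb P^x$ it is a Brownian motion started from $x$ such that $X(t)-X(s)$ is independent of $\mathcal F_s$ for all $s\le t$. Let $\mathcal O=(-\infty,1)$, $\tau_{\mathcal O}=\inf\{t\ge 0: X(t)\notin\mathcal O\}$ and $0<\alpha<\tfrac12$. For functions $f,G,H:[0,\infty)\times\mathbb R\to\mathbb R$ and a (possibly infinite) stopping time $\tau$ put $$J(s,x,\tau)=\mathbb E^x\Big\{\int_0^{\tau\wedge\tau_{\mathcal O}}e^{-\alpha u}f(s+u,X(u))\,du+1_{\{\tau<\tau_{\mathcal O}\}}e^{-\alpha\tau}G(s+\tau,X(\tau))+1_{\{\tau\ge\tau_{\mathcal O}\}}e^{-\alpha\tau_{\mathcal O}}H(s+\tau_{\mathcal O},X(\tau_{\mathcal O}))\Big\}$$ (the last term is $0$ when $\tau_{\mathcal O}=\infty$), and let $w(s,x)=\sup_\tau J(s,x,\tau)$, the supremum being over all stopping times.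 Take $G(s,x)=\min(e^x,e)$ and $f=H=0$. Let $\Phi$ be the standard normal distribution function. Then the following hold. (a) For every $t>0$ the operator $h\mapsto\mathbb E^{x}\{1_{\{t<\tau_{\mathcal O}\}}h(X(t))\}$ maps bounded continuous functions to bounded continuous functions; $\mathbb P^x\{\tau_{\mathcal O}<\eta\}\to0$ as $\eta\downarrow 0$, uniformly in $x$ from compact subsets of $\mathcal O$; and $X$ is strongly Feller, i.e. $x\mapsto\mathbb E^x\{h(X(t))\}$ is continuous for every $t>0$ and every bounded measurable $h$. (b) The supremum $w(s,x)$ is finite and does not depend on $s$; write $w(x)$ for it. (c) For $x<1$ and $t\ge0$, $$l(t,x):=\mathbb E^x\{e^{-\alpha t}1_{\{X(t)<1\}}e^{X(t)}\}=e^{(\frac12-\alpha)t+x}\,\Phi\Big(\frac{1-x-t}{\sqrt t}\Big),$$ where for $t=0$ the last factor is read as $\Phi(+\infty)=1$, i.e. $l(0,x)=e^x$. (d) $w(x)\ge l(t,x)$ for all $x<1$ and $t\ge0$. (e) $w(x)>G(x)$ for all $x<1$. (f) For no $x<1$ does an optimal stopping time exist: there is no stopping time $\tau$ with $J(s,x,\tau)=w(x)$,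 for any $s\ge 0$. (g) $w(x)=0$ for $x\ge1$, and the restriction of $w$ to $\overline{\mathcal O}=(-\infty,1]$ is not continuous at the boundary point $1$. So under the assumptions verified in (a) one can in general neither extend continuity of the value function to the boundary of $\mathcal O$ nor replace $\varepsilon$-optimal stopping times by optimal ones. -/

import Mathlib

open MeasureTheory ProbabilityTheory Filter Topology
open scoped NNReal BoundedContinuousFunction

namespace OptimalStopping

/-- One-dimensional Brownian motion as a Markov process `(Ω, 𝓕, X, (P x)_x)`: the process `X` has
continuous paths and is adapted to `𝓕`; under `P x` it is a Brownian motion started from `x`, and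
its increments after time `s` are independent of `𝓕 s` (the Markov property with respect to `𝓕`). -/
structure IsBrownianMarkovProcess {Ω : Type*} {m : MeasurableSpace Ω}
    (𝓕 : Filtration ℝ≥0 m) (X : ℝ≥0 → Ω → ℝ) (P : ℝ → Measure Ω) : Prop where
  adapted : StronglyAdapted 𝓕 X
  continuous_paths : ∀ ω, Continuous (fun t ↦ X t ω)
  isBrownian : ∀ x : ℝ, IsBrownianReal (fun t ω ↦ X t ω - x) (P x)
  indep_increments : ∀ (x : ℝ) (s t : ℝ≥0), s ≤ t →
    Indep (MeasurableSpace.comap (fun ω ↦ X t ω - X s ω) inferInstance) (𝓕 s) (P x)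

/-- The first exit time `inf {t ≥ 0 : X t ∉ O}`, equal to `⊤` on paths that never leave `O`. -/
noncomputable def exitTime {Ω E : Type*} (X : ℝ≥0 → Ω → E) (O : Set E) : Ω → WithTop ℝ≥0 :=
  hittingAfter X Oᶜ 0

open Classical in
/-- The pathwise payoff of stopping at `τ`: running reward `f` until `τ ∧ τ_O`, terminal reward `G`
if `τ < τ_O` and `H` (paid at `τ_O`) if `τ ≥ τ_O`, everything discounted at rate `α`.
On `τ = τ_O = ∞` the discounted terminal reward is zero. -/
noncomputable def payoff {Ω E : Type*} (X : ℝ≥0 → Ω → E) (O : Set E) (α : ℝ)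
    (f G H : ℝ≥0 → E → ℝ) (s : ℝ≥0) (τ : Ω → WithTop ℝ≥0) (ω : Ω) : ℝ :=
  (∫ u in {u : ℝ | 0 ≤ u ∧ (u.toNNReal : WithTop ℝ≥0) < min (τ ω) (exitTime X O ω)},
      Real.exp (-α * u) * f (s + u.toNNReal) (X u.toNNReal ω))
    + (if τ ω < exitTime X O ω then
        Real.exp (-α * ((τ ω).untopA : ℝ≥0)) * G (s + (τ ω).untopA) (X (τ ω).untopA ω)
      else if exitTime X O ω = ⊤ then 0
      else Real.exp (-α * ((exitTime X O ω).untopA : ℝ≥0)) *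
        H (s + (exitTime X O ω).untopA) (X (exitTime X O ω).untopA ω))

/-- The functional `J(s, x, τ)`: the expectation of the payoff under `P x`. -/
noncomputable def J {Ω E : Type*} {m : MeasurableSpace Ω} (X : ℝ≥0 → Ω → E) (P : E → Measure Ω)
    (O : Set E) (α : ℝ) (f G H : ℝ≥0 → E → ℝ) (s : ℝ≥0) (x : E) (τ : Ω → WithTop ℝ≥0) : ℝ :=
  ∫ ω, payoff X O α f G H s τ ω ∂(P x)

/-- The value function `w(s, x) = sup_τ J(s, x, τ)` over all `𝓕`-stopping times. -/
noncomputable def value {Ω E : Type*} {m : MeasurableSpace Ω} (𝓕 : Filtration ℝ≥0 m)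
    (X : ℝ≥0 → Ω → E) (P : E → Measure Ω)
    (O : Set E) (α : ℝ) (f G H : ℝ≥0 → E → ℝ) (s : ℝ≥0) (x : E) : ℝ :=
  sSup {r : ℝ | ∃ τ : Ω → WithTop ℝ≥0, IsStoppingTime 𝓕 τ ∧ r = J X P O α f G H s x τ}

/-- For `t > 0` the stopped semigroup `h ↦ E^x[1_{t < τ_O} h(X t)]` maps bounded continuous
functions to bounded continuous functions. -/
def StoppedFeller {Ω E : Type*} [TopologicalSpace E] {m : MeasurableSpace Ω}
    (X : ℝ≥0 → Ω → E) (P : E → Measure Ω) (O : Set E) : Prop :=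
  ∀ t : ℝ≥0, 0 < t → ∀ h : E →ᵇ ℝ, ∃ g : E →ᵇ ℝ, ∀ x,
    g x = ∫ ω, {ω | (t : WithTop ℝ≥0) < exitTime X O ω}.indicator (fun ω ↦ h (X t ω)) ω ∂(P x)

/-- `P^x(τ_O < η) → 0` as `η ↓ 0`, uniformly in `x` from compact subsets of `O`. -/
def NoImmediateExit {Ω E : Type*} [TopologicalSpace E] {m : MeasurableSpace Ω}
    (X : ℝ≥0 → Ω → E) (P : E → Measure Ω) (O : Set E) : Prop :=
  ∀ K : Set E, IsCompact K → K ⊆ O →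
    TendstoUniformlyOn
      (fun (η : ℝ≥0) (x : E) ↦ (P x).real {ω | exitTime X O ω < (η : WithTop ℝ≥0)})
      (fun _ ↦ 0) (𝓝[>] 0) K

/-- The strong Feller property: `x ↦ E^x[h(X t)]` is continuous for every `t > 0` and every bounded
measurable `h`. -/
def StrongFeller {Ω E : Type*} [TopologicalSpace E] [MeasurableSpace E] {m : MeasurableSpace Ω}
    (X : ℝ≥0 → Ω → E) (P : E → Measure Ω) : Prop :=
  ∀ t : ℝ≥0, 0 < t → ∀ h : E → ℝ, Measurable h → (∃ C, ∀ y, |h y| ≤ C) →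
    Continuous (fun x ↦ ∫ ω, h (X t ω) ∂(P x))

/-- The reward `G(s, x) = min(e^x, e)`, independent of the time `s`. -/
noncomputable def expReward (_s : ℝ≥0) (x : ℝ) : ℝ := min (Real.exp x) (Real.exp 1)

/-- `l(t, x) = E^x[e^{-α t} 1_{X(t) < 1} e^{X(t)}]`. -/
noncomputable def cutoffMean {Ω : Type*} {m : MeasurableSpace Ω} (X : ℝ≥0 → Ω → ℝ)
    (P : ℝ → Measure Ω) (α : ℝ) (t : ℝ≥0) (x : ℝ) : ℝ :=
  ∫ ω, {ω | X t ω < 1}.indicator (fun ω ↦ Real.exp (-α * t) * Real.exp (X t ω)) ω ∂(P x)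

end OptimalStopping

/-! Put β = √(2α), so that 0 < β < 1. The value function is explicit: w(x) = exp(βx + 1 - β) for x <
1 and w(x) = 0 for x ≥ 1.

Upper bound: for y < 1 the gap (βy + 1 - β) - y = (1 - β)(1 - y) is positive, so the reward e^y lies
strictly below e^{1-β} e^{βy}, and e^{-αt} e^{βX(t)} is a martingale. Optional stopping gives
`J_le`. The same majorant at a fixed time bounds l (`cutoffMean_le`).

Lower bound: stopping on reaching b < 1 earns e^b e^{-β(b-x)}, by the Laplace transform of the
hitting time (`integral_discount_exitTime`); as b ↑ 1 this tends to the upper bound.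

An optimal τ would force equality in the strict majorization, hence τ ≥ τ_O almost surely and a
payoff of zero, although w > 0. Near the boundary w tends to e while w(1) = 0.

Of the regularity properties, the strong Feller property is Gaussian smoothing, and slow exit is
Markov's inequality for the Laplace transform. The stopped Feller property follows by translating
all paths to start at 0 and using that the running maximum has no atoms
(`ae_forall_lt_or_exists_gt`). -/

namespace OptimalStopping

/-! ### Exit times of continuous paths from a half-line. -/

section ExitTime

variable {Ω : Type*} {X : ℝ≥0 → Ω → ℝ} {ω : Ω} {b : ℝ} {t : ℝ≥0}

lemma exitTime_le_of_le (h : b ≤ X t ω) : exitTime X (Set.Iio b) ω ≤ t :=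
  hittingAfter_le_of_mem (zero_le) (by simpa using h)

lemma lt_of_lt_exitTime (h : (t : WithTop ℝ≥0) < exitTime X (Set.Iio b) ω) : X t ω < b := by
  by_contra! hb
  exact absurd h (exitTime_le_of_le hb).not_gt

lemma exists_exitTime_eq (hc : Continuous fun t ↦ X t ω)
    (h : exitTime X (Set.Iio b) ω ≠ ⊤) :
    ∃ s : ℝ≥0, exitTime X (Set.Iio b) ω = s ∧ b ≤ X s ω := by
  have hne : {i : ℝ≥0 | 0 ≤ i ∧ X i ω ∈ (Set.Iio b)ᶜ}.Nonempty := by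
    by_contra! hn
    refine h (hittingAfter_eq_top_iff.2 fun j hj hm ↦ ?_)
    have : j ∈ {i : ℝ≥0 | 0 ≤ i ∧ X i ω ∈ (Set.Iio b)ᶜ} := ⟨hj, hm⟩
    rw [hn] at this
    exact this
  have hcl : IsClosed {i : ℝ≥0 | 0 ≤ i ∧ X i ω ∈ (Set.Iio b)ᶜ} := by
    have : {i : ℝ≥0 | 0 ≤ i ∧ X i ω ∈ (Set.Iio b)ᶜ} = {i | b ≤ X i ω} := by ext; simp
    rw [this]
    exact isClosed_le continuous_const hc
  have hm := hcl.csInf_mem hne (OrderBot.bddBelow _)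
  refine ⟨sInf {i : ℝ≥0 | 0 ≤ i ∧ X i ω ∈ (Set.Iio b)ᶜ}, ?_, not_lt.1 hm.2⟩
  rw [exitTime, hittingAfter]
  exact if_pos hne

lemma lt_exitTime_iff (hc : Continuous fun t ↦ X t ω) :
    (t : WithTop ℝ≥0) < exitTime X (Set.Iio b) ω ↔ ∀ s ≤ t, X s ω < b := by
  refine ⟨fun h s hs ↦ lt_of_lt_exitTime ((WithTop.coe_le_coe.2 hs).trans_lt h), fun h ↦ ?_⟩
  by_contra! hle
  obtain ⟨s, hs, hb⟩ := exists_exitTime_eq hc (ne_top_of_le_ne_top WithTop.coe_ne_top hle)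
  rw [hs, WithTop.coe_le_coe] at hle
  exact (h s hle).not_ge hb

/-- A continuous path stays below `b` on `[0, t]` iff it stays away from `b` at the points of a
dense sequence. -/
lemma forall_lt_iff_exists_denseSeq {p : ℝ≥0 → ℝ} (hp : Continuous p) :
    (∀ s ≤ t, p s < b) ↔
      ∃ n : ℕ, ∀ k : ℕ, p (min (TopologicalSpace.denseSeq ℝ≥0 k) t) ≤ b - 1 / ((n : ℝ) + 1) := by
  constructor
  · intro h
    obtain ⟨s, hs, hmax⟩ := (isCompact_Icc (a := (0 : ℝ≥0)) (b := t)).exists_isMaxOn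
      ⟨0, by simp⟩ hp.continuousOn
    obtain ⟨n, hn⟩ := exists_nat_one_div_lt (sub_pos.2 (h s hs.2))
    refine ⟨n, fun k ↦ ?_⟩
    have : p (min (TopologicalSpace.denseSeq ℝ≥0 k) t) ≤ p s := hmax ⟨zero_le, min_le_right _ _⟩
    linarith
  · rintro ⟨n, hn⟩ s hs
    have hall : ∀ r, p (min r t) ≤ b - 1 / ((n : ℝ) + 1) := by
      have hcl : IsClosed {r : ℝ≥0 | p (min r t) ≤ b - 1 / ((n : ℝ) + 1)} :=
        isClosed_le (by fun_prop) continuous_const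
      intro r
      have := hcl.closure_subset_iff.2 (Set.range_subset_iff.2 hn)
      exact this (by rw [(TopologicalSpace.denseRange_denseSeq ℝ≥0).closure_range]; trivial)
    have h1 := hall s
    rw [min_eq_left hs] at h1
    have : 0 < 1 / ((n : ℝ) + 1) := by positivity
    linarith

/-- The paths that stay below `b` on `[0, t]`, described by countably many coordinates. -/
def stayBelow (b : ℝ) (t : ℝ≥0) : Set (ℝ≥0 → ℝ) :=
  ⋃ n : ℕ, ⋂ k : ℕ, {p | p (min (TopologicalSpace.denseSeq ℝ≥0 k) t) ≤ b - 1 / ((n : ℝ) + 1)}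

lemma measurableSet_stayBelow (b : ℝ) (t : ℝ≥0) : MeasurableSet (stayBelow b t) :=
  .iUnion fun _ ↦ .iInter fun _ ↦ measurableSet_le (measurable_pi_apply _) measurable_const

lemma mem_stayBelow_iff {p : ℝ≥0 → ℝ} (hp : Continuous p) :
    p ∈ stayBelow b t ↔ ∀ s ≤ t, p s < b := by
  rw [forall_lt_iff_exists_denseSeq hp]
  simp [stayBelow]

lemma lt_exitTime_iff_mem_stayBelow (hc : Continuous fun t ↦ X t ω) :
    (t : WithTop ℝ≥0) < exitTime X (Set.Iio b) ω ↔ (fun t ↦ X t ω) ∈ stayBelow b t := by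
  rw [lt_exitTime_iff hc, mem_stayBelow_iff hc]

lemma isStoppingTime_exitTime {m : MeasurableSpace Ω} {𝓕 : Filtration ℝ≥0 m}
    (hX : StronglyAdapted 𝓕 X) (hc : ∀ ω, Continuous fun t ↦ X t ω) (b : ℝ) :
    IsStoppingTime 𝓕 (exitTime X (Set.Iio b)) := by
  intro t
  -- Only coordinates at times min(·, t) occur, so the event lies in `𝓕 t` itself and no
  -- right-continuity of the filtration is needed.
  have : {ω | exitTime X (Set.Iio b) ω ≤ t} =
      (⋃ n : ℕ, ⋂ k : ℕ, {ω | X (min (TopologicalSpace.denseSeq ℝ≥0 k) t) ω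
        ≤ b - 1 / ((n : ℝ) + 1)})ᶜ := by
    ext ω
    rw [Set.mem_compl_iff, Set.mem_ofPred_eq, ← not_lt, lt_exitTime_iff (hc ω),
      forall_lt_iff_exists_denseSeq (hc ω)]
    simp
  rw [this]
  refine (MeasurableSet.iUnion fun n ↦ MeasurableSet.iInter fun k ↦ ?_).compl
  exact measurableSet_le ((hX _).mono (𝓕.mono (min_le_right _ _))).measurable measurable_const

/-- The path is below `b` at all earlier times, so its left limit is at most `b`; time 0 has no left
neighbours, and `h0` covers it. -/
lemma eq_at_exitTime (hc : Continuous fun t ↦ X t ω) (h0 : X 0 ω ≤ b)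
    (h : exitTime X (Set.Iio b) ω = t) : X t ω = b := by
  refine le_antisymm ?_ ?_
  · rcases eq_or_ne t 0 with rfl | ht
    · exact h0
    have h1 : ∀ᶠ s in 𝓝[<] t, X s ω ≤ b := by
      filter_upwards [self_mem_nhdsWithin] with s hs
      exact (lt_of_lt_exitTime (h ▸ WithTop.coe_lt_coe.2 hs)).le
    have : (𝓝[<] t).NeBot := nhdsLT_neBot_of_exists_lt ⟨0, pos_of_ne_zero ht⟩
    exact le_of_tendsto (hc.continuousAt.mono_left nhdsWithin_le_nhds) h1
  · obtain ⟨s, hs, hb⟩ := exists_exitTime_eq hc (h ▸ WithTop.coe_ne_top)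
    rw [h, WithTop.coe_inj] at hs
    exact hs ▸ hb

lemma le_of_le_exitTime (hc : Continuous fun t ↦ X t ω) (h0 : X 0 ω ≤ b)
    (h : (t : WithTop ℝ≥0) ≤ exitTime X (Set.Iio b) ω) : X t ω ≤ b := by
  rcases h.lt_or_eq with h | h
  · exact (lt_of_lt_exitTime h).le
  · exact (eq_at_exitTime hc h0 h.symm).le

end ExitTime

lemma untopA_coe {ι : Type*} [Nonempty ι] (a : ι) : (a : WithTop ι).untopA = a := rfl

/-! ### Optional stopping in continuous time, by discretization from above. -/

section OptionalStopping

variable {Ω : Type*} {m : MeasurableSpace Ω} {𝓕 : Filtration ℝ≥0 m}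

/-- The first point of the grid `ℕ / (n + 1)` at or after `τ`. -/
noncomputable def gridTime (τ : Ω → WithTop ℝ≥0) (n : ℕ) (ω : Ω) : ℝ≥0 :=
  (⌈((n : ℝ≥0) + 1) * (τ ω).untopA⌉₊ : ℝ≥0) / ((n : ℝ≥0) + 1)

lemma untopA_le_gridTime (τ : Ω → WithTop ℝ≥0) (n : ℕ) (ω : Ω) :
    (τ ω).untopA ≤ gridTime τ n ω := by
  rw [gridTime, le_div_iff₀ (by positivity), mul_comm]
  exact Nat.le_ceil _

lemma gridTime_le_add (τ : Ω → WithTop ℝ≥0) (n : ℕ) (ω : Ω) :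
    gridTime τ n ω ≤ (τ ω).untopA + 1 / ((n : ℝ≥0) + 1) := by
  have h := (Nat.ceil_lt_add_one (a := ((n : ℝ≥0) + 1) * (τ ω).untopA) zero_le).le
  rw [gridTime, div_le_iff₀ (by positivity)]
  refine h.trans (le_of_eq ?_)
  field_simp

lemma tendsto_gridTime (τ : Ω → WithTop ℝ≥0) (ω : Ω) :
    Tendsto (fun n ↦ gridTime τ n ω) atTop (𝓝 (τ ω).untopA) := by
  have h : Tendsto (fun n : ℕ ↦ (τ ω).untopA + 1 / ((n : ℝ≥0) + 1)) atTop
      (𝓝 ((τ ω).untopA + 0)) :=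
    tendsto_const_nhds.add tendsto_one_div_add_atTop_nhds_zero_nat
  rw [add_zero] at h
  exact tendsto_of_tendsto_of_tendsto_of_le_of_le tendsto_const_nhds h
    (fun n ↦ untopA_le_gridTime τ n ω) (fun n ↦ gridTime_le_add τ n ω)

/-- Rounding up to the grid lands at or before `t` exactly when `τ` is at most the last grid point
not exceeding `t`. That point is itself ≤ `t`, whence the stopping time property. -/
lemma gridTime_le_iff {τ : Ω → WithTop ℝ≥0} (n : ℕ) {ω : Ω} (hτ : τ ω ≠ ⊤) (t : ℝ≥0) :
    gridTime τ n ω ≤ t ↔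
      τ ω ≤ ((⌊((n : ℝ≥0) + 1) * t⌋₊ / ((n : ℝ≥0) + 1) : ℝ≥0) : WithTop ℝ≥0) := by
  obtain ⟨T, hT⟩ := WithTop.ne_top_iff_exists.1 hτ
  rw [← hT, WithTop.coe_le_coe, gridTime, ← hT, untopA_coe,
    div_le_iff₀ (by positivity), mul_comm t, ← Nat.le_floor_iff zero_le, Nat.ceil_le,
    le_div_iff₀ (by positivity), mul_comm T]

lemma isStoppingTime_gridTime {τ : Ω → WithTop ℝ≥0} (hτ : IsStoppingTime 𝓕 τ)
    (hfin : ∀ ω, τ ω ≠ ⊤) (n : ℕ) : IsStoppingTime 𝓕 fun ω ↦ (gridTime τ n ω : WithTop ℝ≥0) := by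
  intro t
  have : {ω | (gridTime τ n ω : WithTop ℝ≥0) ≤ t} =
      {ω | τ ω ≤ ((⌊((n : ℝ≥0) + 1) * t⌋₊ / ((n : ℝ≥0) + 1) : ℝ≥0) : WithTop ℝ≥0)} := by
    ext ω
    simp only [Set.mem_ofPred_eq, WithTop.coe_le_coe]
    exact gridTime_le_iff n (hfin ω) t
  rw [this]
  refine 𝓕.mono ?_ _ (hτ _)
  rw [div_le_iff₀ (by positivity), mul_comm t]
  exact Nat.floor_le zero_le

/-- An integer belongs to every grid, so rounding up cannot overshoot an integer bound. -/
lemma gridTime_le_natCast {τ : Ω → WithTop ℝ≥0} {N : ℕ} {ω : Ω}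
    (hN : τ ω ≤ ((N : ℝ≥0) : WithTop ℝ≥0)) (n : ℕ) : gridTime τ n ω ≤ N := by
  rw [gridTime_le_iff n (ne_top_of_le_ne_top WithTop.coe_ne_top hN)]
  refine hN.trans (WithTop.coe_le_coe.2 ?_)
  have : ((n : ℝ≥0) + 1) * N = ((n + 1) * N : ℕ) := by push_cast; ring
  rw [this, Nat.floor_natCast, le_div_iff₀ (by positivity)]
  push_cast
  rw [mul_comm]

lemma countable_range_gridTime (τ : Ω → WithTop ℝ≥0) (n : ℕ) :
    (Set.range fun ω ↦ (gridTime τ n ω : WithTop ℝ≥0)).Countable := by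
  refine (Set.countable_range
    fun k : ℕ ↦ (((k : ℝ≥0) / ((n : ℝ≥0) + 1) : ℝ≥0) : WithTop ℝ≥0)).mono ?_
  rintro _ ⟨ω, rfl⟩
  exact ⟨_, rfl⟩

/-- A process with continuous paths, evaluated at a measurable random time, is measurable. -/
lemma measurable_eval_untopA {Y : ℝ≥0 → Ω → ℝ} (hY : StronglyAdapted 𝓕 Y)
    (hc : ∀ ω, Continuous fun t ↦ Y t ω) {τ : Ω → WithTop ℝ≥0} (hτ : IsStoppingTime 𝓕 τ) :
    Measurable fun ω ↦ Y (τ ω).untopA ω :=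
  (measurable_uncurry_of_continuous_of_measurable hc
    fun t ↦ ((hY t).mono (𝓕.le t)).measurable).comp
    ((WithTop.measurable_untopA.comp hτ.measurable').prodMk measurable_id)

/-- **Optional stopping** for a martingale with continuous paths at a bounded stopping time. -/
theorem integrable_and_integral_stoppedValue_eq {μ : Measure Ω} [IsFiniteMeasure μ]
    {M : ℝ≥0 → Ω → ℝ} (hM : Martingale M 𝓕 μ) (hc : ∀ ω, Continuous fun t ↦ M t ω)
    {τ : Ω → WithTop ℝ≥0} (hτ : IsStoppingTime 𝓕 τ) {N : ℕ}
    (hN : ∀ ω, τ ω ≤ ((N : ℝ≥0) : WithTop ℝ≥0)) :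
    Integrable (stoppedValue M τ) μ ∧ ∫ ω, stoppedValue M τ ω ∂μ = ∫ ω, M N ω ∂μ := by
  have hfin : ∀ ω, τ ω ≠ ⊤ := fun ω ↦ ne_top_of_le_ne_top WithTop.coe_ne_top (hN ω)
  set σ : ℕ → Ω → WithTop ℝ≥0 := fun n ω ↦ (gridTime τ n ω : WithTop ℝ≥0) with hσ
  have hst n : IsStoppingTime 𝓕 (σ n) := isStoppingTime_gridTime hτ hfin n
  have hle n ω : σ n ω ≤ ((N : ℝ≥0) : WithTop ℝ≥0) :=
    WithTop.coe_le_coe.2 (gridTime_le_natCast (hN ω) n)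
  have hce n : stoppedValue M (σ n) =ᵐ[μ] μ[M N | (hst n).measurableSpace] :=
    hM.stoppedValue_ae_eq_condExp_of_le_const_of_countable_range (hst n) (hle n)
      (countable_range_gridTime τ n)
  -- Conditional expectations of the single integrable variable `M N` are uniformly integrable; this
  -- turns pathwise convergence along the grids into L¹ convergence.
  have hui : UniformIntegrable (fun n ↦ stoppedValue M (σ n)) 1 μ :=
    ((hM.integrable N).uniformIntegrable_condExp
      fun n ↦ (hst n).measurableSpace_le).ae_eq fun n ↦ (hce n).symm
  have hlim : ∀ ω, Tendsto (fun n ↦ stoppedValue M (σ n) ω) atTop (𝓝 (stoppedValue M τ ω)) := by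
    intro ω
    simp only [stoppedValue, hσ, untopA_coe]
    exact ((hc ω).tendsto _).comp (tendsto_gridTime τ ω)
  have hmeas : AEStronglyMeasurable (stoppedValue M τ) μ :=
    (measurable_eval_untopA hM.1 hc hτ).aestronglyMeasurable
  have hmem : MemLp (stoppedValue M τ) 1 μ :=
    hui.memLp_of_ae_tendsto (ae_of_all _ hlim)
  have hL := tendsto_Lp_finite_of_tendsto_ae le_rfl ENNReal.one_ne_top
    (fun n ↦ (hui.1 n)) hmem hui.2.1 (ae_of_all _ hlim)
  have hint := memLp_one_iff_integrable.1 hmem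
  refine ⟨hint, ?_⟩
  have h1 := tendsto_integral_of_L1' _ hmeas
    (Eventually.of_forall fun n ↦ memLp_one_iff_integrable.1 (hui.memLp n)) hL
  refine tendsto_nhds_unique h1 ?_
  have h2 n : ∫ ω, stoppedValue M (σ n) ω ∂μ = ∫ ω, M N ω ∂μ := by
    rw [integral_congr_ae (hce n), integral_condExp]
  simp_rw [h2]
  exact tendsto_const_nhds

end OptionalStopping

/-! ### The exponential martingale of Brownian motion. -/

section ExponentialMartingale

variable {Ω : Type*} {m : MeasurableSpace Ω} {𝓕 : Filtration ℝ≥0 m} {X : ℝ≥0 → Ω → ℝ}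
  {P : ℝ → Measure Ω}

namespace IsBrownianMarkovProcess

lemma isProbabilityMeasure (hX : IsBrownianMarkovProcess 𝓕 X P) (x : ℝ) :
    IsProbabilityMeasure (P x) :=
  ((hX.isBrownian x).hasLaw_eval 0).isProbabilityMeasure

lemma measurable (hX : IsBrownianMarkovProcess 𝓕 X P) (t : ℝ≥0) : Measurable (X t) :=
  ((hX.adapted t).mono (𝓕.le t)).measurable

lemma hasLaw (hX : IsBrownianMarkovProcess 𝓕 X P) (x : ℝ) (t : ℝ≥0) :
    HasLaw (X t) (gaussianReal x t) (P x) := by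
  have := gaussianReal_const_add ((hX.isBrownian x).hasLaw_eval t) x
  simpa using this

lemma ae_zero_eq (hX : IsBrownianMarkovProcess 𝓕 X P) (x : ℝ) : ∀ᵐ ω ∂(P x), X 0 ω = x := by
  filter_upwards [(hX.isBrownian x).eval_zero_ae_eq_zero] with ω h
  linarith

lemma hasLaw_sub (hX : IsBrownianMarkovProcess 𝓕 X P) (x : ℝ) {s t : ℝ≥0} (hst : s ≤ t) :
    HasLaw (fun ω ↦ X t ω - X s ω) (gaussianReal 0 (t - s)) (P x) := by
  have h := (hX.isBrownian x).hasLaw_sub t s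
  have h1 : nndist t.1 s.1 = t - s := by
    rw [← NNReal.coe_inj, coe_nndist, NNReal.val_eq_coe, NNReal.val_eq_coe, Real.dist_eq, NNReal.coe_sub hst, abs_of_nonneg]
    exact sub_nonneg.2 (NNReal.coe_le_coe.2 hst)
  rw [h1] at h
  convert h using 2
  simp

end IsBrownianMarkovProcess

/-- The exponential martingale `exp (β X t - β² t / 2)`. -/
noncomputable def expMart (X : ℝ≥0 → Ω → ℝ) (β : ℝ) (t : ℝ≥0) (ω : Ω) : ℝ :=
  Real.exp (β * X t ω - β ^ 2 / 2 * t)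

lemma continuous_expMart {ω : Ω} (hc : Continuous fun t ↦ X t ω) (β : ℝ) :
    Continuous fun t ↦ expMart X β t ω := by
  unfold expMart
  fun_prop

lemma integrable_exp_mul_of_hasLaw {μ : Measure Ω} {Y : Ω → ℝ} {a : ℝ} {v : ℝ≥0}
    (hY : HasLaw Y (gaussianReal a v) μ) (β : ℝ) : Integrable (fun ω ↦ Real.exp (β * Y ω)) μ := by
  have := integrable_exp_mul_gaussianReal (μ := a) (v := v) β
  rw [← hY.map_eq] at this
  exact this.comp_aemeasurable hY.aemeasurable

lemma integral_exp_mul_of_hasLaw {μ : Measure Ω} {Y : Ω → ℝ} {a : ℝ} {v : ℝ≥0}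
    (hY : HasLaw Y (gaussianReal a v) μ) (β : ℝ) :
    ∫ ω, Real.exp (β * Y ω) ∂μ = Real.exp (a * β + v * β ^ 2 / 2) :=
  mgf_gaussianReal hY.map_eq β

lemma IsBrownianMarkovProcess.integrable_expMart (hX : IsBrownianMarkovProcess 𝓕 X P) (x β : ℝ)
    (t : ℝ≥0) : Integrable (expMart X β t) (P x) := by
  have := (integrable_exp_mul_of_hasLaw (hX.hasLaw x t) β).mul_const (Real.exp (-(β ^ 2 / 2 * t)))
  refine this.congr (ae_of_all _ fun ω ↦ ?_)
  simp only [expMart, ← Real.exp_add]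
  ring_nf

lemma IsBrownianMarkovProcess.integral_expMart (hX : IsBrownianMarkovProcess 𝓕 X P) (x β : ℝ)
    (t : ℝ≥0) : ∫ ω, expMart X β t ω ∂(P x) = Real.exp (β * x) := by
  have h1 : ∀ ω, expMart X β t ω = Real.exp (β * X t ω) * Real.exp (-(β ^ 2 / 2 * t)) := by
    intro ω
    simp only [expMart, ← Real.exp_add]
    ring_nf
  simp_rw [h1]
  rw [integral_mul_const, integral_exp_mul_of_hasLaw (hX.hasLaw x t), ← Real.exp_add]
  ring_nf

lemma IsBrownianMarkovProcess.martingale_expMart (hX : IsBrownianMarkovProcess 𝓕 X P) (x β : ℝ) :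
    Martingale (expMart X β) 𝓕 (P x) := by
  have := hX.isProbabilityMeasure x
  have had : StronglyAdapted 𝓕 (expMart X β) := fun t ↦
    (Real.measurable_exp.comp
      (((hX.adapted t).measurable.const_mul β).sub_const _)).stronglyMeasurable
  refine ⟨had, fun s t hst ↦ ?_⟩
  set D : Ω → ℝ := fun ω ↦ X t ω - X s ω with hD
  set E : Ω → ℝ := fun ω ↦ Real.exp (β * D ω) * Real.exp (-(β ^ 2 / 2 * (t - s))) with hE
  have hlaw := hX.hasLaw_sub x hst
  have hEint : Integrable E (P x) := (integrable_exp_mul_of_hasLaw hlaw β).mul_const _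
  -- The multiplicative increment `E` has mean one and is independent of `𝓕 s`, so it drops out of
  -- the conditional expectation.
  have hfac : expMart X β t = expMart X β s * E := by
    ext ω
    simp only [expMart, hE, hD, Pi.mul_apply, ← Real.exp_add]
    ring_nf
  have hEmean : ∫ ω, E ω ∂(P x) = 1 := by
    simp only [hE]
    rw [integral_mul_const, integral_exp_mul_of_hasLaw hlaw, ← Real.exp_add, Real.exp_eq_one_iff,
      NNReal.coe_sub hst]
    ring
  have hEmeas : StronglyMeasurable[MeasurableSpace.comap D inferInstance] E :=
    (((Real.measurable_exp.comp ((comap_measurable D).const_mul β)).mul_const _)).stronglyMeasurable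
  have hind : (P x)[E | 𝓕 s] =ᵐ[P x] fun _ ↦ ∫ ω, E ω ∂(P x) :=
    condExp_indep_eq ((hX.measurable t).sub (hX.measurable s)).comap_le (𝓕.le s) hEmeas
      (hX.indep_increments x s t hst)
  have h2 := condExp_mul_of_stronglyMeasurable_left (had s) (g := E) (μ := P x)
    (hfac ▸ hX.integrable_expMart x β t) hEint
  rw [hfac]
  filter_upwards [h2, hind] with ω h2 h3
  rw [h2, Pi.mul_apply, h3, hEmean, mul_one]

/-- The exponential martingale is integrable with mean `exp (β x)` at `min τ N`. -/
lemma IsBrownianMarkovProcess.integral_stopped_expMart (hX : IsBrownianMarkovProcess 𝓕 X P)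
    (x β : ℝ) {τ : Ω → WithTop ℝ≥0} (hτ : IsStoppingTime 𝓕 τ) (N : ℕ) :
    Integrable (fun ω ↦ expMart X β (min (τ ω) ((N : ℝ≥0) : WithTop ℝ≥0)).untopA ω) (P x) ∧
    ∫ ω, expMart X β (min (τ ω) ((N : ℝ≥0) : WithTop ℝ≥0)).untopA ω ∂(P x) = Real.exp (β * x) := by
  have := hX.isProbabilityMeasure x
  have h := integrable_and_integral_stoppedValue_eq (hX.martingale_expMart x β)
    (fun ω ↦ continuous_expMart (hX.continuous_paths ω) β) (hτ.min_const (N : ℝ≥0)) (N := N)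
    (fun ω ↦ min_le_right _ _)
  rw [hX.integral_expMart] at h
  exact h

end ExponentialMartingale

/-! ### Laplace transform of the hitting time of a level. -/

section Laplace

variable {Ω : Type*} {m : MeasurableSpace Ω} {𝓕 : Filtration ℝ≥0 m} {X : ℝ≥0 → Ω → ℝ}
  {P : ℝ → Measure Ω}

open Classical in
/-- `exp (-r τ)`, read as zero for `τ = ∞`. -/
noncomputable def discount (r : ℝ) (τ : WithTop ℝ≥0) : ℝ :=
  if τ = ⊤ then 0 else Real.exp (-r * (τ.untopA : ℝ≥0))

@[simp] lemma discount_top (r : ℝ) : discount r ⊤ = 0 := if_pos rfl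

@[simp] lemma discount_coe (r : ℝ) (t : ℝ≥0) : discount r t = Real.exp (-r * t) :=
  if_neg WithTop.coe_ne_top

lemma discount_nonneg (r : ℝ) (τ : WithTop ℝ≥0) : 0 ≤ discount r τ := by
  cases τ
  · rw [discount_top]
  · rw [discount_coe]
    exact Real.exp_nonneg _

lemma discount_le_one {r : ℝ} (hr : 0 ≤ r) (τ : WithTop ℝ≥0) : discount r τ ≤ 1 := by
  cases τ
  · simp
  · rw [discount_coe, Real.exp_le_one_iff, neg_mul]
    exact neg_nonpos.2 (by positivity)

lemma discount_antitone {r : ℝ} (hr : 0 ≤ r) : Antitone (discount r) := by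
  intro σ τ h
  cases τ with
  | top => exact discount_top r ▸ discount_nonneg r σ
  | coe t =>
    cases σ with
    | top => exact absurd h (not_le.2 (WithTop.coe_lt_top t))
    | coe s =>
      have hst : (s : ℝ) ≤ t := NNReal.coe_le_coe.2 (WithTop.coe_le_coe.1 h)
      simp only [discount_coe]
      gcongr 1
      nlinarith

lemma discount_lt {r : ℝ} (hr : 0 < r) {σ τ : WithTop ℝ≥0} (h : σ < τ) :
    discount r τ < discount r σ := by
  cases σ with
  | top => simp at h
  | coe s =>
    cases τ with
    | top =>
      rw [discount_top, discount_coe]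
      exact Real.exp_pos _
    | coe t =>
      have hst : (s : ℝ) < t := NNReal.coe_lt_coe.2 (WithTop.coe_lt_coe.1 h)
      simp only [discount_coe]
      gcongr 1
      nlinarith

lemma measurable_discount (r : ℝ) : Measurable (discount r) := by
  refine WithTop.measurable_of_measurable_comp_coe ?_
  simp only [discount_coe]
  fun_prop

lemma IsBrownianMarkovProcess.isStoppingTime_exitTime (hX : IsBrownianMarkovProcess 𝓕 X P)
    (b : ℝ) :
    IsStoppingTime 𝓕 (exitTime X (Set.Iio b)) :=
  OptimalStopping.isStoppingTime_exitTime hX.adapted hX.continuous_paths b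

lemma IsBrownianMarkovProcess.integrable_discount (hX : IsBrownianMarkovProcess 𝓕 X P)
    (x : ℝ) {r : ℝ} (hr : 0 ≤ r)
    {τ : Ω → WithTop ℝ≥0} (hτ : IsStoppingTime 𝓕 τ) :
    Integrable (fun ω ↦ discount r (τ ω)) (P x) := by
  have := hX.isProbabilityMeasure x
  refine .of_bound ((measurable_discount r).comp hτ.measurable').aestronglyMeasurable 1
    (ae_of_all _ fun ω ↦ ?_)
  rw [Real.norm_of_nonneg (discount_nonneg _ _)]
  exact discount_le_one hr _

/-- The Laplace transform of the exit time of Brownian motion from a half-line. -/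
theorem IsBrownianMarkovProcess.integral_discount_exitTime (hX : IsBrownianMarkovProcess 𝓕 X P)
    {x b r : ℝ} (hr : 0 < r) (hb : x ≤ b) :
    ∫ ω, discount r (exitTime X (Set.Iio b) ω) ∂(P x) =
      Real.exp (-(Real.sqrt (2 * r) * (b - x))) := by
  have := hX.isProbabilityMeasure x
  set β := Real.sqrt (2 * r) with hβ
  have hβ0 : 0 ≤ β := Real.sqrt_nonneg _
  have hβ2 : β ^ 2 / 2 = r := by rw [hβ, Real.sq_sqrt (by positivity)]; ring
  set σ := exitTime X (Set.Iio b) with hσ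
  have hst : IsStoppingTime 𝓕 σ := hX.isStoppingTime_exitTime b
  -- Up to `σ` the path stays at or below `b`. This bound dominates the stopped martingale and makes
  -- it vanish in the limit where `σ = ⊤`.
  have hle : ∀ᵐ ω ∂(P x), ∀ t : ℝ≥0, (t : WithTop ℝ≥0) ≤ σ ω →
      expMart X β t ω ≤ Real.exp (β * b) * Real.exp (-r * t) := by
    filter_upwards [hX.ae_zero_eq x] with ω h0 t ht
    have := le_of_le_exitTime (hX.continuous_paths ω) (h0.le.trans hb) ht
    rw [expMart, hβ2, ← Real.exp_add]
    gcongr 1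
    nlinarith
  have hlim := tendsto_integral_of_dominated_convergence
    (F := fun (N : ℕ) ω ↦ expMart X β (min (σ ω) ((N : ℝ≥0) : WithTop ℝ≥0)).untopA ω)
    (f := fun ω ↦ Real.exp (β * b) * discount r (σ ω)) (μ := P x)
    (fun _ ↦ Real.exp (β * b)) (fun N ↦ (hX.integral_stopped_expMart x β hst N).1.1)
    (integrable_const _) (fun N ↦ ?_) ?_
  · simp_rw [(hX.integral_stopped_expMart x β hst _).2] at hlim
    have h := tendsto_nhds_unique hlim tendsto_const_nhds
    rw [integral_const_mul] at h
    have h2 : Real.exp (-(β * (b - x))) = Real.exp (-(β * b)) * Real.exp (β * x) := by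
      rw [← Real.exp_add]; ring_nf
    rw [h2, ← h, ← mul_assoc, ← Real.exp_add]
    simp
  · filter_upwards [hle] with ω h
    obtain ⟨t, ht⟩ := WithTop.ne_top_iff_exists.1
      (ne_top_of_le_ne_top WithTop.coe_ne_top (min_le_right (σ ω) ((N : ℝ≥0) : WithTop ℝ≥0)))
    rw [← ht, untopA_coe, Real.norm_of_nonneg (by exact Real.exp_nonneg _)]
    refine (h t (ht ▸ min_le_left _ _)).trans (mul_le_of_le_one_right (Real.exp_nonneg _) ?_)
    rw [Real.exp_le_one_iff, neg_mul]
    exact neg_nonpos.2 (by positivity)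
  · filter_upwards [hle, hX.ae_zero_eq x] with ω h h0
    cases hs : σ ω with
    | top =>
      simp only [discount_top, mul_zero, le_top, inf_of_le_right, untopA_coe]
      have h1 : Tendsto (fun N : ℕ ↦ Real.exp (β * b) * Real.exp (-r * ((N : ℝ≥0) : ℝ))) atTop
          (𝓝 (Real.exp (β * b) * 0)) := by
        refine Tendsto.const_mul _ (Real.tendsto_exp_atBot.comp ?_)
        simp only [NNReal.coe_natCast]
        exact tendsto_natCast_atTop_atTop.const_mul_atTop_of_neg (by linarith)
      rw [mul_zero] at h1
      exact squeeze_zero (fun N ↦ Real.exp_nonneg _) (fun N ↦ h N (by simp [hs])) h1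
    | coe s =>
      have hev : ∀ᶠ N : ℕ in atTop, s ≤ N := (eventually_ge_atTop ⌈s⌉₊).mono
        fun N hN ↦ Nat.ceil_le.1 hN
      refine tendsto_const_nhds.congr' ?_
      filter_upwards [hev] with N hN
      rw [min_eq_left (WithTop.coe_le_coe.2 hN), untopA_coe, expMart, hβ2, discount_coe,
        eq_at_exitTime (hX.continuous_paths ω) (h0.le.trans hb) hs, ← Real.exp_add]
      ring_nf

end Laplace

/-! ### The value function in closed form. -/

section Value

variable {Ω : Type*} {m : MeasurableSpace Ω} {𝓕 : Filtration ℝ≥0 m} {X : ℝ≥0 → Ω → ℝ}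
  {P : ℝ → Measure Ω}

open Classical in
-- Before the exit from (-∞, 1) the cap in min(e^x, e) is inactive.
lemma payoff_eq_ite (α : ℝ) (s : ℝ≥0) (τ : Ω → WithTop ℝ≥0) (ω : Ω) :
    payoff X (Set.Iio 1) α 0 expReward 0 s τ ω =
      if τ ω < exitTime X (Set.Iio 1) ω then
        discount α (τ ω) * Real.exp (X (τ ω).untopA ω) else 0 := by
  simp only [payoff, Pi.zero_apply, mul_zero, integral_zero, zero_add, ite_self]
  split_ifs with h
  · obtain ⟨t, ht⟩ := WithTop.ne_top_iff_exists.1 (ne_top_of_lt h)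
    rw [← ht] at h ⊢
    simp only [untopA_coe, discount_coe, expReward]
    rw [min_eq_left (Real.exp_le_exp.2 (lt_of_lt_exitTime h).le)]
  · rfl

open Classical in
/-- The payoff with `exp y` replaced by the larger function `exp (β y + 1 - β)`. -/
noncomputable def upperPayoff (X : ℝ≥0 → Ω → ℝ) (α β : ℝ) (τ : Ω → WithTop ℝ≥0) (ω : Ω) : ℝ :=
  if τ ω < exitTime X (Set.Iio 1) ω then
    discount α (τ ω) * Real.exp (β * X (τ ω).untopA ω + 1 - β) else 0

lemma upperPayoff_nonneg (α β : ℝ) (τ : Ω → WithTop ℝ≥0) (ω : Ω) :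
    0 ≤ upperPayoff X α β τ ω := by
  rw [upperPayoff]
  split_ifs
  · exact mul_nonneg (discount_nonneg _ _) (Real.exp_nonneg _)
  · exact le_rfl

lemma upperPayoff_le {α β : ℝ} (hα : 0 ≤ α) (hβ : 0 ≤ β) (τ : Ω → WithTop ℝ≥0) (ω : Ω) :
    upperPayoff X α β τ ω ≤ Real.exp 1 := by
  rw [upperPayoff]
  split_ifs with h
  · obtain ⟨t, ht⟩ := WithTop.ne_top_iff_exists.1 (ne_top_of_lt h)
    refine (mul_le_of_le_one_left (Real.exp_nonneg _) (discount_le_one hα _)).trans ?_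
    rw [← ht] at h ⊢
    have := lt_of_lt_exitTime h
    rw [untopA_coe, Real.exp_le_exp]
    nlinarith
  · exact Real.exp_nonneg _

lemma payoff_lt_upperPayoff {α β : ℝ} (hβ : β < 1) (s : ℝ≥0) {τ : Ω → WithTop ℝ≥0} {ω : Ω}
    (h : τ ω < exitTime X (Set.Iio 1) ω) :
    payoff X (Set.Iio 1) α 0 expReward 0 s τ ω < upperPayoff X α β τ ω := by
  rw [payoff_eq_ite, if_pos h, upperPayoff, if_pos h]
  obtain ⟨t, ht⟩ := WithTop.ne_top_iff_exists.1 (ne_top_of_lt h)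
  rw [← ht] at h ⊢
  have := lt_of_lt_exitTime h
  rw [untopA_coe, discount_coe]
  gcongr 2
  nlinarith

lemma payoff_le_upperPayoff {α β : ℝ} (hβ : β < 1) (s : ℝ≥0) (τ : Ω → WithTop ℝ≥0) (ω : Ω) :
    payoff X (Set.Iio 1) α 0 expReward 0 s τ ω ≤ upperPayoff X α β τ ω := by
  by_cases h : τ ω < exitTime X (Set.Iio 1) ω
  · exact (payoff_lt_upperPayoff hβ s h).le
  · rw [payoff_eq_ite, if_neg h, upperPayoff, if_neg h]

namespace IsBrownianMarkovProcess

lemma measurableSet_lt_exitTime (hX : IsBrownianMarkovProcess 𝓕 X P)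
    (b : ℝ) {τ : Ω → WithTop ℝ≥0} (hτ : IsStoppingTime 𝓕 τ) :
    MeasurableSet {ω | τ ω < exitTime X (Set.Iio b) ω} :=
  measurableSet_lt hτ.measurable' (hX.isStoppingTime_exitTime b).measurable'

lemma integrable_upperPayoff (hX : IsBrownianMarkovProcess 𝓕 X P)
    (x : ℝ) {α β : ℝ} (hα : 0 ≤ α) (hβ : 0 ≤ β)
    {τ : Ω → WithTop ℝ≥0} (hτ : IsStoppingTime 𝓕 τ) : Integrable (upperPayoff X α β τ) (P x) := by
  have := hX.isProbabilityMeasure x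
  refine .of_bound (Measurable.aestronglyMeasurable ?_) (Real.exp 1) (ae_of_all _ fun ω ↦ ?_)
  · refine Measurable.ite (hX.measurableSet_lt_exitTime 1 hτ) ?_ measurable_const
    refine ((measurable_discount α).comp hτ.measurable').mul (Real.measurable_exp.comp ?_)
    exact (((measurable_eval_untopA hX.adapted hX.continuous_paths hτ).const_mul β).add_const
      1).sub_const β
  · rw [Real.norm_of_nonneg (upperPayoff_nonneg _ _ _ _)]
    exact upperPayoff_le hα hβ _ _

lemma integrable_payoff (hX : IsBrownianMarkovProcess 𝓕 X P)
    (x : ℝ) {α : ℝ} (hα : 0 ≤ α) (s : ℝ≥0)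
    {τ : Ω → WithTop ℝ≥0} (hτ : IsStoppingTime 𝓕 τ) :
    Integrable (payoff X (Set.Iio 1) α 0 expReward 0 s τ) (P x) := by
  -- For β = 1 the majorant is the payoff itself.
  refine (hX.integrable_upperPayoff x hα zero_le_one hτ).congr (ae_of_all _ fun ω ↦ ?_)
  simp [upperPayoff, payoff_eq_ite]

/-- On `τ ≤ N` the majorant is at most e^{1-β} times the exponential martingale at `min τ N`, whose
mean is e^{βx}. Then `N → ∞`; on `τ = ⊤` the majorant is zero, so nothing is lost. -/
lemma integral_upperPayoff_le (hX : IsBrownianMarkovProcess 𝓕 X P)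
    (x : ℝ) {α : ℝ} (hα : 0 < α)
    {τ : Ω → WithTop ℝ≥0} (hτ : IsStoppingTime 𝓕 τ) :
    ∫ ω, upperPayoff X α (Real.sqrt (2 * α)) τ ω ∂(P x) ≤
      Real.exp (Real.sqrt (2 * α) * x + 1 - Real.sqrt (2 * α)) := by
  have := hX.isProbabilityMeasure x
  set β := Real.sqrt (2 * α) with hβ
  have hβ0 : 0 ≤ β := Real.sqrt_nonneg _
  have hβ2 : β ^ 2 / 2 = α := by rw [hβ, Real.sq_sqrt (by positivity)]; ring
  set A : ℕ → Set Ω := fun N ↦ {ω | τ ω ≤ ((N : ℝ≥0) : WithTop ℝ≥0)}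
  have hA N : MeasurableSet (A N) := 𝓕.le _ _ (hτ _)
  have hint := hX.integrable_upperPayoff x hα.le hβ0 hτ
  have hbound N : ∫ ω, (A N).indicator (upperPayoff X α β τ) ω ∂(P x) ≤
      Real.exp (β * x + 1 - β) := by
    obtain ⟨h1, h2⟩ := hX.integral_stopped_expMart x β hτ N
    have : Real.exp (β * x + 1 - β) = Real.exp (1 - β) *
        ∫ ω, expMart X β (min (τ ω) ((N : ℝ≥0) : WithTop ℝ≥0)).untopA ω ∂(P x) := by
      rw [h2, ← Real.exp_add]; ring_nf
    rw [this, ← integral_const_mul]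
    refine integral_mono (hint.indicator (hA N)) (h1.const_mul _) fun ω ↦ ?_
    by_cases hω : ω ∈ A N
    · rw [Set.indicator_of_mem hω]
      simp only
      rw [min_eq_left hω, upperPayoff]
      split_ifs with h
      · obtain ⟨t, ht⟩ := WithTop.ne_top_iff_exists.1 (ne_top_of_lt h)
        rw [← ht, untopA_coe, discount_coe, expMart, hβ2, ← Real.exp_add, ← Real.exp_add]
        exact le_of_eq (by ring_nf)
      · exact mul_nonneg (Real.exp_nonneg _) (Real.exp_nonneg _)
    · rw [Set.indicator_of_notMem hω]
      exact mul_nonneg (Real.exp_nonneg _) (Real.exp_nonneg _)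
  refine le_of_tendsto' (tendsto_integral_of_dominated_convergence (fun ω ↦ upperPayoff X α β τ ω)
    (fun N ↦ (hint.indicator (hA N)).1) hint (fun N ↦ ae_of_all _ fun ω ↦ ?_)
    (ae_of_all _ fun ω ↦ ?_)) hbound
  · refine (norm_indicator_le_norm_self _ _).trans ?_
    rw [Real.norm_of_nonneg (upperPayoff_nonneg _ _ _ _)]
  · refine tendsto_const_nhds.congr' ?_
    cases h : τ ω with
    | top => exact Eventually.of_forall fun N ↦ by simp [Set.indicator, upperPayoff, h]
    | coe t =>
      filter_upwards [eventually_ge_atTop ⌈t⌉₊] with N hN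
      rw [Set.indicator_of_mem]
      change τ ω ≤ _
      rw [h]
      exact WithTop.coe_le_coe.2 (Nat.ceil_le.1 hN)

lemma J_le (hX : IsBrownianMarkovProcess 𝓕 X P)
    (x : ℝ) {α : ℝ} (hα : 0 < α) (hα' : Real.sqrt (2 * α) < 1) (s : ℝ≥0)
    {τ : Ω → WithTop ℝ≥0} (hτ : IsStoppingTime 𝓕 τ) :
    J X P (Set.Iio 1) α 0 expReward 0 s x τ ≤
      Real.exp (Real.sqrt (2 * α) * x + 1 - Real.sqrt (2 * α)) :=
  (integral_mono (hX.integrable_payoff x hα.le s hτ)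
    (hX.integrable_upperPayoff x hα.le (Real.sqrt_nonneg _) hτ)
    fun ω ↦ payoff_le_upperPayoff hα' s τ ω).trans (hX.integral_upperPayoff_le x hα hτ)

/-- No stopping time attains the upper bound. -/
lemma J_lt (hX : IsBrownianMarkovProcess 𝓕 X P)
    (x : ℝ) {α : ℝ} (hα : 0 < α) (hα' : Real.sqrt (2 * α) < 1) (s : ℝ≥0)
    {τ : Ω → WithTop ℝ≥0} (hτ : IsStoppingTime 𝓕 τ) :
    J X P (Set.Iio 1) α 0 expReward 0 s x τ <
      Real.exp (Real.sqrt (2 * α) * x + 1 - Real.sqrt (2 * α)) := by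
  have hp := hX.integrable_payoff x hα.le s hτ
  have hu := hX.integrable_upperPayoff x hα.le (Real.sqrt_nonneg (2 * α)) hτ
  have hle : ∀ ω, payoff X (Set.Iio 1) α 0 expReward 0 s τ ω ≤
      upperPayoff X α (Real.sqrt (2 * α)) τ ω := payoff_le_upperPayoff hα' s τ
  by_contra! hge
  have heq : ∫ ω, payoff X (Set.Iio 1) α 0 expReward 0 s τ ω ∂(P x) =
      ∫ ω, upperPayoff X α (Real.sqrt (2 * α)) τ ω ∂(P x) :=
    le_antisymm (integral_mono hp hu hle) ((hX.integral_upperPayoff_le x hα hτ).trans hge)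
  have hae := (integral_eq_iff_of_ae_le hp hu (ae_of_all _ hle)).1 heq
  -- Equality with the majorant excludes stopping before exit, where the inequality is strict; hence
  -- nothing is ever paid.
  have hzero : payoff X (Set.Iio 1) α 0 expReward 0 s τ =ᵐ[P x] 0 := by
    filter_upwards [hae] with ω h
    have : ¬ τ ω < exitTime X (Set.Iio 1) ω := fun hlt ↦ (payoff_lt_upperPayoff hα' s hlt).ne h
    rw [payoff_eq_ite, if_neg this, Pi.zero_apply]
  rw [J, integral_congr_ae hzero] at hge
  simp only [Pi.zero_apply, integral_zero] at hge
  exact (Real.exp_pos _).not_ge hge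

/-- The gain of stopping upon reaching the level `b < 1`. -/
lemma J_exitTime (hX : IsBrownianMarkovProcess 𝓕 X P)
    {x b α : ℝ} (hα : 0 < α) (hxb : x ≤ b) (hb : b < 1) (s : ℝ≥0) :
    J X P (Set.Iio 1) α 0 expReward 0 s x (exitTime X (Set.Iio b)) =
      Real.exp b * Real.exp (-(Real.sqrt (2 * α) * (b - x))) := by
  rw [J, ← hX.integral_discount_exitTime hα hxb, ← integral_const_mul]
  refine integral_congr_ae ?_
  filter_upwards [hX.ae_zero_eq x] with ω h0
  rw [payoff_eq_ite]
  cases h : exitTime X (Set.Iio b) ω with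
  | top => simp
  | coe t =>
    have hXt := eq_at_exitTime (hX.continuous_paths ω) (h0.le.trans hxb) h
    rw [if_pos, untopA_coe, hXt, mul_comm]
    rw [lt_exitTime_iff (hX.continuous_paths ω)]
    intro r hr
    refine (le_of_le_exitTime (hX.continuous_paths ω) (h0.le.trans hxb) ?_).trans_lt hb
    rw [h]
    exact WithTop.coe_le_coe.2 hr

lemma isLUB_J_of_lt_one (hX : IsBrownianMarkovProcess 𝓕 X P)
    {x α : ℝ} (hα : 0 < α) (hα' : Real.sqrt (2 * α) < 1) (hx : x < 1)
    (s : ℝ≥0) :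
    IsLUB {r : ℝ | ∃ τ : Ω → WithTop ℝ≥0, IsStoppingTime 𝓕 τ ∧
        r = J X P (Set.Iio 1) α 0 expReward 0 s x τ}
      (Real.exp (Real.sqrt (2 * α) * x + 1 - Real.sqrt (2 * α))) := by
  refine ⟨?_, fun c hc ↦ ?_⟩
  · rintro _ ⟨τ, hτ, rfl⟩
    exact hX.J_le x hα hα' s hτ
  · have hcont : Tendsto (fun b ↦ Real.exp b * Real.exp (-(Real.sqrt (2 * α) * (b - x))))
        (𝓝[<] 1) (𝓝 (Real.exp 1 * Real.exp (-(Real.sqrt (2 * α) * (1 - x))))) := by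
      refine Tendsto.mono_left ?_ nhdsWithin_le_nhds
      exact Continuous.tendsto (by fun_prop) 1
    have heq : Real.exp 1 * Real.exp (-(Real.sqrt (2 * α) * (1 - x))) =
        Real.exp (Real.sqrt (2 * α) * x + 1 - Real.sqrt (2 * α)) := by
      rw [← Real.exp_add]; ring_nf
    rw [← heq]
    refine le_of_tendsto hcont ?_
    filter_upwards [Ioo_mem_nhdsLT hx] with b hb
    rw [← hX.J_exitTime hα hb.1.le hb.2 s]
    exact hc ⟨_, hX.isStoppingTime_exitTime b, rfl⟩

lemma J_eq_zero (hX : IsBrownianMarkovProcess 𝓕 X P)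
    {x : ℝ} (hx : 1 ≤ x) (α : ℝ) (s : ℝ≥0) (τ : Ω → WithTop ℝ≥0) :
    J X P (Set.Iio 1) α 0 expReward 0 s x τ = 0 := by
  rw [J]
  refine integral_eq_zero_of_ae ?_
  filter_upwards [hX.ae_zero_eq x] with ω h0
  have h1 : exitTime X (Set.Iio 1) ω ≤ (0 : ℝ≥0) := exitTime_le_of_le (h0 ▸ hx)
  rw [payoff_eq_ite, if_neg, Pi.zero_apply]
  exact not_lt.2 (h1.trans bot_le)

lemma isLUB_J_of_one_le (hX : IsBrownianMarkovProcess 𝓕 X P)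
    {x : ℝ} (hx : 1 ≤ x) (α : ℝ) (s : ℝ≥0) :
    IsLUB {r : ℝ | ∃ τ : Ω → WithTop ℝ≥0, IsStoppingTime 𝓕 τ ∧
        r = J X P (Set.Iio 1) α 0 expReward 0 s x τ} 0 := by
  have : {r : ℝ | ∃ τ : Ω → WithTop ℝ≥0, IsStoppingTime 𝓕 τ ∧
        r = J X P (Set.Iio 1) α 0 expReward 0 s x τ} = {0} := by
    ext r
    simp only [hX.J_eq_zero hx, Set.mem_ofPred_eq, Set.mem_singleton_iff]
    exact ⟨fun ⟨_, _, h⟩ ↦ h, fun h ↦ ⟨_, isStoppingTime_const 𝓕 0, h⟩⟩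
  rw [this]
  exact isLUB_singleton

lemma value_of_lt_one (hX : IsBrownianMarkovProcess 𝓕 X P)
    {x α : ℝ} (hα : 0 < α) (hα' : Real.sqrt (2 * α) < 1) (hx : x < 1)
    (s : ℝ≥0) : value 𝓕 X P (Set.Iio 1) α 0 expReward 0 s x =
      Real.exp (Real.sqrt (2 * α) * x + 1 - Real.sqrt (2 * α)) :=
  (hX.isLUB_J_of_lt_one hα hα' hx s).csSup_eq ⟨_, _, isStoppingTime_const 𝓕 0, rfl⟩

lemma value_of_one_le (hX : IsBrownianMarkovProcess 𝓕 X P)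
    {x : ℝ} (hx : 1 ≤ x) (α : ℝ) (s : ℝ≥0) :
    value 𝓕 X P (Set.Iio 1) α 0 expReward 0 s x = 0 :=
  (hX.isLUB_J_of_one_le hx α s).csSup_eq ⟨_, _, isStoppingTime_const 𝓕 0, rfl⟩

end IsBrownianMarkovProcess

end Value

/-! ### Gaussian densities: continuity in the mean and exponential tilting. -/

section Gaussian

/-- An integrable bound uniform over means near `x₀`, for dominated convergence; it rests on (y -
x₀)² ≤ 2(y - x)² + 2. -/
lemma gaussianPDFReal_le_of_dist_le_one {x x₀ y : ℝ} {v : ℝ≥0} (hv : v ≠ 0)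
    (hx : dist x x₀ ≤ 1) :
    gaussianPDFReal x v y ≤ (Real.sqrt (2 * Real.pi * v))⁻¹ * Real.exp (1 / (2 * v)) *
      Real.exp (-(1 / (4 * v)) * (y - x₀) ^ 2) := by
  have hv' : (0 : ℝ) < v := NNReal.coe_pos.2 (pos_of_ne_zero hv)
  have h1 : (x - x₀) ^ 2 ≤ 1 := by
    rw [Real.dist_eq] at hx
    exact (sq_le_one_iff_abs_le_one _).2 hx
  rw [gaussianPDFReal, mul_assoc _ (Real.exp _), ← Real.exp_add]
  gcongr 2
  have h2 : (y - x₀) ^ 2 ≤ 2 * (y - x) ^ 2 + 2 := by nlinarith [sq_nonneg (y - x - (x - x₀))]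
  have h3 : 1 / (2 * v) + -(1 / (4 * v)) * (y - x₀) ^ 2 - -(y - x) ^ 2 / (2 * v) =
      (2 * (y - x) ^ 2 + 2 - (y - x₀) ^ 2) / (4 * (v : ℝ)) := by
    field_simp
    ring
  have h4 : 0 ≤ (2 * (y - x) ^ 2 + 2 - (y - x₀) ^ 2) / (4 * (v : ℝ)) :=
    div_nonneg (by linarith) (by positivity)
  linarith

lemma continuous_gaussianPDFReal_mean (v : ℝ≥0) (y : ℝ) :
    Continuous fun x ↦ gaussianPDFReal x v y := by
  unfold gaussianPDFReal
  fun_prop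

/-- Gaussian smoothing of a bounded measurable function is continuous. -/
lemma continuous_integral_gaussianReal {v : ℝ≥0} (hv : v ≠ 0) {h : ℝ → ℝ} (hm : Measurable h)
    {C : ℝ} (hC : ∀ y, |h y| ≤ C) : Continuous fun x ↦ ∫ y, h y ∂(gaussianReal x v) := by
  simp_rw [integral_gaussianReal_eq_integral_smul hv, smul_eq_mul]
  refine continuous_iff_continuousAt.2 fun x₀ ↦ ?_
  have hv' : (0 : ℝ) < v := NNReal.coe_pos.2 (pos_of_ne_zero hv)
  refine continuousAt_of_dominated (bound := fun y ↦ (Real.sqrt (2 * Real.pi * v))⁻¹ *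
    Real.exp (1 / (2 * v)) * Real.exp (-(1 / (4 * v)) * (y - x₀) ^ 2) * C)
    (Eventually.of_forall fun x ↦
      ((measurable_gaussianPDFReal x v).mul hm).aestronglyMeasurable) ?_ ?_
    (ae_of_all _ fun y ↦ ((continuous_gaussianPDFReal_mean v y).mul continuous_const).continuousAt)
  · filter_upwards [Metric.closedBall_mem_nhds x₀ one_pos] with x hx
    refine ae_of_all _ fun y ↦ ?_
    rw [norm_mul, Real.norm_of_nonneg (gaussianPDFReal_nonneg _ _ _), Real.norm_eq_abs]
    have := gaussianPDFReal_le_of_dist_le_one (y := y) hv hx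
    exact mul_le_mul this (hC y) (abs_nonneg _) ((gaussianPDFReal_nonneg _ _ _).trans this)
  · exact (((integrable_exp_neg_mul_sq (by positivity : (0 : ℝ) < 1 / (4 * v))).comp_sub_right
      x₀).const_mul _).mul_const _

/-- Completing the square: the factor e^y shifts the mean by the variance. -/
lemma exp_mul_gaussianPDFReal (x : ℝ) {v : ℝ≥0} (hv : v ≠ 0) (y : ℝ) :
    gaussianPDFReal x v y * Real.exp y =
      Real.exp (x + v / 2) * gaussianPDFReal (x + v) v y := by
  have hv' : (v : ℝ) ≠ 0 := NNReal.coe_ne_zero.2 hv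
  simp only [gaussianPDFReal]
  rw [mul_assoc, ← Real.exp_add, mul_left_comm, ← Real.exp_add]
  congr 2
  field_simp
  ring

lemma gaussianReal_real_Iio (x b : ℝ) {v : ℝ≥0} (hv : v ≠ 0) :
    (gaussianReal x v).real (Set.Iio b) = cdf (gaussianReal 0 1) ((b - x) / Real.sqrt v) := by
  have hv' : (0 : ℝ) < v := NNReal.coe_pos.2 (pos_of_ne_zero hv)
  have hs : 0 < Real.sqrt v := Real.sqrt_pos.2 hv'
  have hmap : (gaussianReal 0 1).map (fun z ↦ Real.sqrt v * z + x) = gaussianReal x v := by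
    have h1 := gaussianReal_const_mul (HasLaw.id (μ := gaussianReal 0 1)) (Real.sqrt v)
    have h2 := (gaussianReal_add_const h1 x).map_eq
    simp only [id_eq, mul_zero, zero_add, mul_one] at h2
    rw [h2]
    congr 1
    exact NNReal.coe_injective (Real.sq_sqrt v.2)
  have : NullSingletonClass (gaussianReal 0 1) := nullSingletonClass_gaussianReal one_ne_zero
  rw [cdf_eq_real, ← hmap, map_measureReal_apply (by fun_prop) measurableSet_Iio,
    ← measureReal_congr Iio_ae_eq_Iic]
  congr 1
  ext z
  simp only [Set.mem_preimage, Set.mem_Iio]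
  rw [lt_div_iff₀ hs]
  constructor <;> intro h <;> linarith

lemma setIntegral_exp_gaussianReal (x b : ℝ) {v : ℝ≥0} (hv : v ≠ 0) :
    ∫ y in Set.Iio b, Real.exp y ∂(gaussianReal x v) =
      Real.exp (x + v / 2) * cdf (gaussianReal 0 1) ((b - x - v) / Real.sqrt v) := by
  rw [sub_sub, ← gaussianReal_real_Iio _ _ hv, ← integral_indicator measurableSet_Iio,
    integral_gaussianReal_eq_integral_smul hv]
  have h1 : ∀ y, gaussianPDFReal x v y • (Set.Iio b).indicator Real.exp y =
      Real.exp (x + v / 2) *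
        (gaussianPDFReal (x + v) v y • (Set.Iio b).indicator (fun _ ↦ (1 : ℝ)) y) := by
    intro y
    by_cases hy : y ∈ Set.Iio b
    · simp only [Set.indicator_of_mem hy, smul_eq_mul, mul_one]
      exact exp_mul_gaussianPDFReal x hv y
    · simp [Set.indicator_of_notMem hy]
  have h2 : (fun y ↦ gaussianPDFReal x v y • (Set.Iio b).indicator (fun y ↦ Real.exp y) y) =
      fun y ↦ Real.exp (x + v / 2) *
        (gaussianPDFReal (x + v) v y • (Set.Iio b).indicator (fun _ ↦ (1 : ℝ)) y) := funext h1
  rw [h2, integral_const_mul, ← integral_gaussianReal_eq_integral_smul hv,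
    integral_indicator measurableSet_Iio]
  simp

end Gaussian

/-! ### Strong Feller property, slow exit, and the cutoff mean. -/

section Regularity

variable {Ω : Type*} {m : MeasurableSpace Ω} {𝓕 : Filtration ℝ≥0 m} {X : ℝ≥0 → Ω → ℝ}
  {P : ℝ → Measure Ω}

namespace IsBrownianMarkovProcess

theorem strongFeller (hX : IsBrownianMarkovProcess 𝓕 X P) : StrongFeller X P := by
  rintro t ht h hm ⟨C, hC⟩
  refine (continuous_integral_gaussianReal ht.ne' hm hC).congr fun x ↦ ?_
  exact ((hX.hasLaw x t).integral_comp (f := h) hm.aestronglyMeasurable).symm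

theorem noImmediateExit (hX : IsBrownianMarkovProcess 𝓕 X P) (b : ℝ) :
    NoImmediateExit X P (Set.Iio b) := by
  intro K hK hKb
  rcases K.eq_empty_or_nonempty with rfl | hne
  · exact tendstoUniformlyOn_empty
  obtain ⟨z, hz, hmax⟩ := hK.exists_isMaxOn hne continuousOn_id
  set d := b - z with hd
  have hd0 : 0 < d := sub_pos.2 (hKb hz)
  have hbound : ∀ η : ℝ≥0, 0 < η → ∀ x ∈ K,
      (P x).real {ω | exitTime X (Set.Iio b) ω < (η : WithTop ℝ≥0)} ≤
        Real.exp (1 - Real.sqrt (2 * (1 / η)) * d) := by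
    intro η hη x hx
    have := hX.isProbabilityMeasure x
    have hη' : (0 : ℝ) < η := NNReal.coe_pos.2 hη
    have hxz : x ≤ z := hmax hx
    -- With rate 1/η, exit before η makes the discount at least e^{-1}, so Markov's inequality
    -- applies at that level.
    have hL := hX.integral_discount_exitTime (x := x) (b := b) (r := 1 / η) (by positivity)
      (hxz.trans (hKb hz).le)
    have hint := hX.integrable_discount x (r := 1 / (η : ℝ)) (by positivity)
      (hX.isStoppingTime_exitTime b)
    have hmarkov := mul_meas_ge_le_integral_of_nonneg
      (ae_of_all (P x) fun ω ↦ discount_nonneg _ _) hint (Real.exp (-1))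
    have hsub : (P x).real {ω | exitTime X (Set.Iio b) ω < (η : WithTop ℝ≥0)} ≤
        (P x).real {ω | Real.exp (-1) ≤ discount (1 / (η : ℝ)) (exitTime X (Set.Iio b) ω)} := by
      refine measureReal_mono fun ω hω ↦ ?_
      have h1 := discount_antitone (r := 1 / (η : ℝ)) (by positivity) (le_of_lt hω)
      rw [discount_coe] at h1
      refine le_trans (le_of_eq ?_) h1
      congr 1
      field_simp
    have h2 : Real.exp (-(Real.sqrt (2 * (1 / η)) * (b - x))) ≤
        Real.exp (-(Real.sqrt (2 * (1 / η)) * d)) := by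
      gcongr 3
      exact sub_le_sub_left hxz b
    rw [hL] at hmarkov
    have h3 : Real.exp (1 - Real.sqrt (2 * (1 / η)) * d) =
        Real.exp 1 * Real.exp (-(Real.sqrt (2 * (1 / η)) * d)) := by
      rw [← Real.exp_add]; ring_nf
    have h4 : Real.exp 1 * Real.exp (-1) = 1 := by rw [← Real.exp_add]; simp
    rw [h3]
    calc _ ≤ _ := hsub
      _ = Real.exp 1 * (Real.exp (-1) * (P x).real
          {ω | Real.exp (-1) ≤ discount (1 / (η : ℝ)) (exitTime X (Set.Iio b) ω)}) := by
        rw [← mul_assoc, h4, one_mul]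
      _ ≤ _ := by
        gcongr
        exact hmarkov.trans h2
  have hlim : Tendsto (fun η : ℝ≥0 ↦ Real.exp (1 - Real.sqrt (2 * (1 / η)) * d)) (𝓝[>] 0)
      (𝓝 0) := by
    refine Real.tendsto_exp_atBot.comp ?_
    have h1 : Tendsto (fun η : ℝ≥0 ↦ (η : ℝ)) (𝓝[>] 0) (𝓝[>] 0) := by
      refine tendsto_nhdsWithin_iff.2 ⟨?_, ?_⟩
      · exact Tendsto.mono_left (NNReal.continuous_coe.tendsto 0) nhdsWithin_le_nhds
      · filter_upwards [self_mem_nhdsWithin] with η hη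
        exact NNReal.coe_pos.2 hη
    have h2 : Tendsto (fun η : ℝ≥0 ↦ Real.sqrt (2 * (1 / (η : ℝ))) * d) (𝓝[>] 0) atTop := by
      simp_rw [one_div]
      exact (Real.tendsto_sqrt_atTop.comp
        ((tendsto_inv_nhdsGT_zero.comp h1).const_mul_atTop two_pos)).atTop_mul_const hd0
    simp_rw [sub_eq_add_neg]
    exact tendsto_atBot_add_const_left _ _ (tendsto_neg_atTop_atBot.comp h2)
  rw [Metric.tendstoUniformlyOn_iff]
  intro ε hε
  filter_upwards [hlim.eventually (gt_mem_nhds hε), self_mem_nhdsWithin] with η h1 h2 x hx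
  rw [dist_zero_left, Real.norm_of_nonneg measureReal_nonneg]
  exact (hbound η h2 x hx).trans_lt h1

lemma cutoffMean_eq (hX : IsBrownianMarkovProcess 𝓕 X P) (α x : ℝ) {t : ℝ≥0} (ht : 0 < t) :
    cutoffMean X P α t x = Real.exp ((1 / 2 - α) * t + x) *
      cdf (gaussianReal 0 1) ((1 - x - t) / Real.sqrt t) := by
  have h1 : cutoffMean X P α t x =
      ∫ ω, (fun y ↦ (Set.Iio (1 : ℝ)).indicator (fun y ↦ Real.exp (-α * t) * Real.exp y) y) (X t ω)
        ∂(P x) := rfl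
  rw [h1]
  have h2 := (hX.hasLaw x t).integral_comp
    (f := fun y ↦ (Set.Iio (1 : ℝ)).indicator (fun y ↦ Real.exp (-α * t) * Real.exp y) y)
    (Measurable.indicator (by fun_prop) measurableSet_Iio).aestronglyMeasurable
  refine h2.trans ?_
  rw [integral_indicator measurableSet_Iio, integral_const_mul,
    setIntegral_exp_gaussianReal _ _ ht.ne', ← mul_assoc, ← Real.exp_add]
  ring_nf

lemma cutoffMean_zero (hX : IsBrownianMarkovProcess 𝓕 X P) (α : ℝ) {x : ℝ} (hx : x < 1) :
    cutoffMean X P α 0 x = Real.exp x := by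
  have := hX.isProbabilityMeasure x
  have h1 : cutoffMean X P α 0 x = ∫ _, Real.exp x ∂(P x) := by
    refine integral_congr_ae ?_
    filter_upwards [hX.ae_zero_eq x] with ω h0
    rw [Set.indicator_of_mem (by simpa [h0] using hx), h0]
    simp
  simp [h1]

/-- The cutoff only asks that X(t) < 1, even if the path has left the domain before. So l is
compared with the martingale majorant directly, not with the gain of stopping at `t`. -/
lemma cutoffMean_le (hX : IsBrownianMarkovProcess 𝓕 X P) {α : ℝ} (hα : 0 < α)
    (hα' : Real.sqrt (2 * α) < 1) (x : ℝ) (t : ℝ≥0) :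
    cutoffMean X P α t x ≤ Real.exp (Real.sqrt (2 * α) * x + 1 - Real.sqrt (2 * α)) := by
  set β := Real.sqrt (2 * α) with hβ
  have hβ2 : β ^ 2 / 2 = α := by rw [hβ, Real.sq_sqrt (by positivity)]; ring
  have h1 : Real.exp (β * x + 1 - β) = ∫ ω, Real.exp (1 - β) * expMart X β t ω ∂(P x) := by
    rw [integral_const_mul, hX.integral_expMart, ← Real.exp_add]
    ring_nf
  rw [h1, cutoffMean]
  refine integral_mono_of_nonneg (ae_of_all _ fun ω ↦ ?_)
    ((hX.integrable_expMart x β t).const_mul _) (ae_of_all _ fun ω ↦ ?_)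
  · exact Set.indicator_nonneg (fun _ _ ↦ mul_nonneg (Real.exp_nonneg _) (Real.exp_nonneg _)) _
  · by_cases hω : X t ω < 1
    · simp only
      rw [Set.indicator_of_mem (by exact hω), expMart, hβ2, ← Real.exp_add, ← Real.exp_add]
      gcongr 1
      nlinarith
    · simp only
      rw [Set.indicator_of_notMem (by exact hω)]
      exact mul_nonneg (Real.exp_nonneg _) (Real.exp_nonneg _)

end IsBrownianMarkovProcess

end Regularity

/-! ### Stopped Feller property. -/

section StoppedFeller

variable {Ω : Type*} {m : MeasurableSpace Ω} {𝓕 : Filtration ℝ≥0 m} {X : ℝ≥0 → Ω → ℝ}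
  {P : ℝ → Measure Ω}

namespace IsBrownianMarkovProcess

lemma measurable_path (hX : IsBrownianMarkovProcess 𝓕 X P) (x : ℝ) :
    Measurable fun ω t ↦ X t ω - x :=
  measurable_pi_lambda _ fun t ↦ (hX.measurable t).sub_const x

/-- The law of the centered path does not depend on the starting point. -/
lemma map_path_eq (hX : IsBrownianMarkovProcess 𝓕 X P) (x y : ℝ) :
    (P x).map (fun ω t ↦ X t ω - x) = (P y).map (fun ω t ↦ X t ω - y) := by
  have h (z : ℝ) : IsProjectiveLimit ((P z).map (fun ω t ↦ X t ω - z))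
      BrownianReal.projectiveFamily := by
    have h1 := isProjectiveLimit_map (P := P z) (X := fun t ω ↦ X t ω - z)
      (hX.measurable_path z).aemeasurable
    intro I
    exact (h1 I).trans ((hX.isBrownian z).hasLaw I).map_eq
  exact (h x).unique (h y)

/-- The running maximum over `[0, t]`, `t > 0`, has no atoms. -/
lemma ae_forall_lt_or_exists_gt (hX : IsBrownianMarkovProcess 𝓕 X P) (x b : ℝ) {t : ℝ≥0}
    (ht : 0 < t) :
    ∀ᵐ ω ∂(P x), (∀ s ≤ t, X s ω < b) ∨ ∃ s ≤ t, b < X s ω := by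
  have := hX.isProbabilityMeasure x
  rcases lt_or_ge b x with hbx | hxb
  · filter_upwards [hX.ae_zero_eq x] with ω h0
    exact Or.inr ⟨0, ht.le, by rwa [h0]⟩
  set bn : ℕ → ℝ := fun n ↦ b + 1 / ((n : ℝ) + 1) with hbn
  have hbn_gt n : b < bn n := lt_add_of_pos_right _ (by positivity)
  have hbn_lim : Tendsto bn atTop (𝓝 b) := by
    simpa [hbn] using (tendsto_one_div_add_atTop_nhds_zero_nat (𝕜 := ℝ)).const_add b
  set σ := exitTime X (Set.Iio b) with hσ
  have hσst : IsStoppingTime 𝓕 σ := hX.isStoppingTime_exitTime b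
  have hst n := hX.isStoppingTime_exitTime (bn n)
  -- The bad event: `b` is reached before `t`, but no level `bn n` is reached by `t`. There the
  -- discounts at the two hitting times differ by at least `ψ`. The mean difference is explicit and
  -- tends to 0, so `B` is null. First reaching `b` exactly at `t` is excluded separately by `hne`.
  set B : Set Ω := {ω | σ ω < t} ∩ ⋂ n, {ω | (t : WithTop ℝ≥0) < exitTime X (Set.Iio (bn n)) ω}
  have hB : MeasurableSet B :=
    (measurableSet_lt hσst.measurable' measurable_const).inter
      (.iInter fun n ↦ measurableSet_lt measurable_const (hst n).measurable')
  set ψ : Ω → ℝ := B.indicator fun ω ↦ discount 1 (σ ω) - discount 1 t with hψ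
  have hψ0 : 0 ≤ ψ := fun ω ↦ Set.indicator_nonneg
    (fun ω hω ↦ sub_nonneg.2 (discount_lt one_pos hω.1).le) ω
  have hψint : Integrable ψ (P x) :=
    ((hX.integrable_discount x zero_le_one hσst).sub (integrable_const _)).indicator hB
  have hψle n : ∫ ω, ψ ω ∂(P x) ≤ Real.exp (-(Real.sqrt (2 * 1) * (b - x))) -
      Real.exp (-(Real.sqrt (2 * 1) * (bn n - x))) := by
    rw [← hX.integral_discount_exitTime one_pos hxb,
      ← hX.integral_discount_exitTime one_pos (hxb.trans (hbn_gt n).le),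
      ← integral_sub (hX.integrable_discount x zero_le_one hσst)
        (hX.integrable_discount x zero_le_one (hst n))]
    refine integral_mono hψint ((hX.integrable_discount x zero_le_one hσst).sub
        (hX.integrable_discount x zero_le_one (hst n))) fun ω ↦ ?_
    by_cases hω : ω ∈ B
    · rw [hψ, Set.indicator_of_mem hω]
      exact sub_le_sub_left (discount_antitone zero_le_one (Set.mem_iInter.1 hω.2 n).le) _
    · rw [hψ, Set.indicator_of_notMem hω]
      refine sub_nonneg.2 (discount_antitone zero_le_one ?_)
      exact hittingAfter_anti X 0 (Set.compl_subset_compl.2 (Set.Iio_subset_Iio (hbn_gt n).le)) ω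
  have hlim : Tendsto (fun n ↦ Real.exp (-(Real.sqrt (2 * 1) * (b - x))) -
      Real.exp (-(Real.sqrt (2 * 1) * (bn n - x)))) atTop (𝓝 0) := by
    have h : Continuous fun y : ℝ ↦ Real.exp (-(Real.sqrt (2 * 1) * (b - x))) -
      Real.exp (-(Real.sqrt (2 * 1) * (y - x))) := by fun_prop
    have h' := (h.tendsto b).comp hbn_lim
    rwa [sub_self] at h'
  have hzero : ∫ ω, ψ ω ∂(P x) = 0 :=
    le_antisymm (ge_of_tendsto' hlim hψle) (integral_nonneg hψ0)
  have hae := (integral_eq_zero_iff_of_nonneg hψ0 hψint).1 hzero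
  have hne : ∀ᵐ ω ∂(P x), X t ω ≠ b := by
    have : NullSingletonClass (gaussianReal x t) := nullSingletonClass_gaussianReal ht.ne'
    refine ((hX.hasLaw x t).ae_iff (p := fun y ↦ y ≠ b) ?_).2 (Measure.ae_ne _ b)
    exact measurableSet_setOfPred.1 (measurableSet_singleton b).compl
  filter_upwards [hae, hne, hX.ae_zero_eq x] with ω h1 h2 h0
  have hc := hX.continuous_paths ω
  by_contra! hcon
  obtain ⟨⟨s, hs, hbs⟩, hle⟩ := hcon
  have hσt : σ ω ≤ t := (exitTime_le_of_le hbs).trans (WithTop.coe_le_coe.2 hs)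
  have hgt n : (t : WithTop ℝ≥0) < exitTime X (Set.Iio (bn n)) ω :=
    (lt_exitTime_iff hc).2 fun r hr ↦ (hle r hr).trans_lt (hbn_gt n)
  rcases hσt.lt_or_eq with hlt | heq
  · have hω : ω ∈ B := ⟨hlt, Set.mem_iInter.2 hgt⟩
    rw [hψ, Set.indicator_of_mem hω] at h1
    exact (sub_pos.2 (discount_lt one_pos hlt)).ne' h1
  · exact h2 (eq_at_exitTime hc (h0.le.trans hxb) heq)

/-- The stopped semigroup written as an expectation under the single measure `P 0`. -/
lemma integral_stopped_eq (hX : IsBrownianMarkovProcess 𝓕 X P) (b x : ℝ) (t : ℝ≥0) (h : ℝ →ᵇ ℝ) :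
    ∫ ω, {ω | (t : WithTop ℝ≥0) < exitTime X (Set.Iio b) ω}.indicator (fun ω ↦ h (X t ω)) ω ∂(P x) =
      ∫ ω, {ω | (t : WithTop ℝ≥0) < exitTime X (Set.Iio (b - x)) ω}.indicator
        (fun ω ↦ h (X t ω + x)) ω ∂(P 0) := by
  set F : (ℝ≥0 → ℝ) → ℝ := (stayBelow (b - x) t).indicator fun p ↦ h (p t + x) with hF
  have hFm : Measurable F :=
    Measurable.indicator (h.continuous.measurable.comp (by fun_prop))
      (measurableSet_stayBelow _ _)
  have key (z : ℝ) : ∫ ω, F (fun s ↦ X s ω - z) ∂(P z) =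
      ∫ p, F p ∂((P 0).map fun ω s ↦ X s ω - 0) := by
    rw [hX.map_path_eq 0 z, integral_map (hX.measurable_path z).aemeasurable
      hFm.aestronglyMeasurable]
  have h1 : ∀ ω, {ω | (t : WithTop ℝ≥0) < exitTime X (Set.Iio b) ω}.indicator
      (fun ω ↦ h (X t ω)) ω = F (fun s ↦ X s ω - x) := by
    intro ω
    have hc : Continuous fun s ↦ X s ω - x := (hX.continuous_paths ω).sub continuous_const
    have hiff : (t : WithTop ℝ≥0) < exitTime X (Set.Iio b) ω ↔
        (fun s ↦ X s ω - x) ∈ stayBelow (b - x) t := by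
      rw [lt_exitTime_iff (hX.continuous_paths ω), mem_stayBelow_iff hc]
      simp
    by_cases hω : (t : WithTop ℝ≥0) < exitTime X (Set.Iio b) ω
    · rw [Set.indicator_of_mem (by exact hω), hF, Set.indicator_of_mem (hiff.1 hω), sub_add_cancel]
    · rw [Set.indicator_of_notMem (by exact hω), hF, Set.indicator_of_notMem (mt hiff.2 hω)]
  have h2 : ∀ ω, {ω | (t : WithTop ℝ≥0) < exitTime X (Set.Iio (b - x)) ω}.indicator
      (fun ω ↦ h (X t ω + x)) ω = F (fun s ↦ X s ω - 0) := by
    intro ω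
    have hiff := lt_exitTime_iff_mem_stayBelow (b := b - x) (t := t) (hX.continuous_paths ω)
    simp only [sub_zero]
    by_cases hω : (t : WithTop ℝ≥0) < exitTime X (Set.Iio (b - x)) ω
    · rw [Set.indicator_of_mem (by exact hω), hF, Set.indicator_of_mem (hiff.1 hω)]
    · rw [Set.indicator_of_notMem (by exact hω), hF, Set.indicator_of_notMem (mt hiff.2 hω)]
  simp_rw [h1, h2]
  rw [key x, key 0]

theorem stoppedFeller (hX : IsBrownianMarkovProcess 𝓕 X P) (b : ℝ) :
    StoppedFeller X P (Set.Iio b) := by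
  intro t ht h
  have := hX.isProbabilityMeasure 0
  set g : ℝ → ℝ := fun x ↦ ∫ ω, {ω | (t : WithTop ℝ≥0) < exitTime X (Set.Iio (b - x)) ω}.indicator
    (fun ω ↦ h (X t ω + x)) ω ∂(P 0) with hg
  have hbd (x : ℝ) (ω : Ω) : ‖{ω | (t : WithTop ℝ≥0) < exitTime X (Set.Iio (b - x)) ω}.indicator
      (fun ω ↦ h (X t ω + x)) ω‖ ≤ ‖h‖ :=
    (norm_indicator_le_norm_self _ _).trans (h.norm_coe_le_norm _)
  have hcont : Continuous g := by
    refine continuous_iff_continuousAt.2 fun x₀ ↦ ?_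
    refine continuousAt_of_dominated (bound := fun _ ↦ ‖h‖) (Eventually.of_forall fun x ↦ ?_)
      (Eventually.of_forall fun x ↦ ae_of_all _ (hbd x)) (integrable_const _) ?_
    · exact (Measurable.indicator
        (h.continuous.measurable.comp ((hX.measurable t).add_const x))
        (measurableSet_lt measurable_const
          (hX.isStoppingTime_exitTime _).measurable')).aestronglyMeasurable
    · filter_upwards [hX.ae_forall_lt_or_exists_gt 0 (b - x₀) ht] with ω hω
      have hc := hX.continuous_paths ω
      -- In either case the indicator is locally constant in the starting point: 1 near `x₀` if the
      -- maximum is strictly below the level, 0 if it is strictly above.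
      rcases hω with hlt | ⟨s, hs, hgt⟩
      · obtain ⟨s, hs, hmax⟩ := (isCompact_Icc (a := (0 : ℝ≥0)) (b := t)).exists_isMaxOn
          ⟨0, by simp⟩ hc.continuousOn
        have hev : ∀ᶠ x in 𝓝 x₀, X s ω < b - x :=
          (continuous_const.sub continuous_id).continuousAt.eventually (lt_mem_nhds (hlt s hs.2))
        have hct : ContinuousAt (fun x ↦ h (X t ω + x)) x₀ := by fun_prop
        refine hct.congr ?_
        filter_upwards [hev] with x hx
        rw [Set.indicator_of_mem]
        exact (lt_exitTime_iff hc).2 fun r hr ↦ (hmax ⟨zero_le, hr⟩).trans_lt hx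
      · have hev : ∀ᶠ x in 𝓝 x₀, b - x < X s ω :=
          (continuous_const.sub continuous_id).continuousAt.eventually (gt_mem_nhds hgt)
        refine (continuousAt_const (y := (0 : ℝ))).congr ?_
        filter_upwards [hev] with x hx
        rw [Set.indicator_of_notMem]
        exact fun hlt ↦ hx.not_gt ((lt_exitTime_iff hc).1 hlt s hs)
  refine ⟨BoundedContinuousFunction.ofNormedAddCommGroup g hcont ‖h‖ fun x ↦ ?_, fun x ↦ ?_⟩
  · refine (norm_integral_le_of_norm_le_const (ae_of_all _ (hbd x))).trans ?_
    simp
  · exact (hX.integral_stopped_eq b x t h).symm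

end IsBrownianMarkovProcess

end StoppedFeller

end OptimalStopping

theorem mainTheorem11 {Ω : Type*} {m : MeasurableSpace Ω} (𝓕 : Filtration ℝ≥0 m)
    (X : ℝ≥0 → Ω → ℝ) (P : ℝ → Measure Ω)
    (hX : OptimalStopping.IsBrownianMarkovProcess 𝓕 X P)
    (α : ℝ) (hα0 : 0 < α) (hα : α < 1 / 2)
    (O : Set ℝ) (hO : O = Set.Iio 1)
    (G : ℝ≥0 → ℝ → ℝ) (hG : G = OptimalStopping.expReward)
    (J : ℝ≥0 → ℝ → (Ω → WithTop ℝ≥0) → ℝ) (hJ : J = OptimalStopping.J X P O α 0 G 0)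
    (w : ℝ≥0 → ℝ → ℝ) (hw : w = OptimalStopping.value 𝓕 X P O α 0 G 0)
    (l : ℝ≥0 → ℝ → ℝ) (hl : l = OptimalStopping.cutoffMean X P α) :
    -- the process and the set satisfy the regularity assumptions
    OptimalStopping.StoppedFeller X P O ∧
    OptimalStopping.NoImmediateExit X P O ∧
    OptimalStopping.StrongFeller X P ∧
    -- the supremum defining the value function is a genuine, finite one, independent of time
    (∀ s x, IsLUB {r : ℝ | ∃ τ, IsStoppingTime 𝓕 τ ∧ r = J s x τ} (w s x)) ∧
    (∀ s s' x, w s x = w s' x) ∧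
    -- the formula for `l`; at `t = 0` the factor `Φ(+∞) = 1` is written out
    (∀ x < 1, ∀ t : ℝ≥0, 0 < t →
      l t x = Real.exp ((1 / 2 - α) * t + x) *
        cdf (gaussianReal 0 1) ((1 - x - t) / Real.sqrt t)) ∧
    (∀ x < 1, l 0 x = Real.exp x) ∧
    -- lower bound and strict domination
    (∀ s, ∀ x < 1, ∀ t : ℝ≥0, l t x ≤ w s x) ∧
    (∀ s, ∀ x < 1, G s x < w s x) ∧
    -- no optimal stopping time
    (∀ s, ∀ x < 1, ¬ ∃ τ : Ω → WithTop ℝ≥0, IsStoppingTime 𝓕 τ ∧ J s x τ = w s x) ∧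
    -- the value function vanishes off `O` and is not continuous up to the boundary of `O`
    (∀ s, ∀ x ∉ O, w s x = 0) ∧
    (∀ s, ¬ ContinuousWithinAt (w s) (closure O) 1) := by
  subst hO hG hJ hw hl
  have hβ : Real.sqrt (2 * α) < 1 := by
    rw [Real.sqrt_lt' one_pos]
    linarith
  have hval := fun s x (hx : x < 1) ↦ hX.value_of_lt_one hα0 hβ hx s
  refine ⟨hX.stoppedFeller 1, hX.noImmediateExit 1, hX.strongFeller, fun s x ↦ ?_,
    fun s s' x ↦ ?_, fun x _ t ht ↦ hX.cutoffMean_eq α x ht, fun x hx ↦ hX.cutoffMean_zero α hx,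
    fun s x hx t ↦ ?_, fun s x hx ↦ ?_, fun s x hx ↦ ?_, fun s x hx ↦ ?_, fun s hcont ↦ ?_⟩
  · rcases lt_or_ge x 1 with hx | hx
    · rw [hval s x hx]
      exact hX.isLUB_J_of_lt_one hα0 hβ hx s
    · rw [hX.value_of_one_le hx]
      exact hX.isLUB_J_of_one_le hx α s
  · rcases lt_or_ge x 1 with hx | hx
    · rw [hval s x hx, hval s' x hx]
    · rw [hX.value_of_one_le hx, hX.value_of_one_le hx]
  · rw [hval s x hx]
    exact hX.cutoffMean_le hα0 hβ x t
  · rw [hval s x hx]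
    refine (min_le_left _ _).trans_lt (Real.exp_lt_exp.2 ?_)
    -- The difference of the exponents is (1 - β)(1 - x) > 0.
    nlinarith
  · rintro ⟨τ, hτ, h⟩
    rw [hval s x hx] at h
    exact (hX.J_lt x hα0 hβ s hτ).ne h
  · exact hX.value_of_one_le (not_lt.1 hx) α s
  · have h1 : Tendsto (fun x ↦ Real.exp (Real.sqrt (2 * α) * x + 1 - Real.sqrt (2 * α))) (𝓝[<] 1)
        (𝓝 (Real.exp (Real.sqrt (2 * α) * 1 + 1 - Real.sqrt (2 * α)))) :=
      Tendsto.mono_left (Continuous.tendsto (by fun_prop) 1) nhdsWithin_le_nhds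
    have h2 : Tendsto (OptimalStopping.value 𝓕 X P (Set.Iio 1) α 0 OptimalStopping.expReward 0 s)
        (𝓝[<] 1) (𝓝 0) := by
      rw [← hX.value_of_one_le le_rfl α s]
      exact hcont.mono_left (nhdsWithin_mono _ subset_closure)
    -- Continuity at 1 would give the left limit `w s 1 = 0`, against the positive limit of the
    -- closed formula.
    have h3 := h2.congr' (eventually_nhdsWithin_of_forall fun x hx ↦ hval s x hx)
    exact (Real.exp_pos _).ne' (tendsto_nhds_unique h1 h3)
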